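/- For each integer $n\ge 2$ consider the following Markov chain $(x_k)_{k\ge 0}$ on $\mathbb{R}^n$. It starts from $x_0=(1,0,\ldots,0)$. Given $x_k=(x_{k,1},\ldots,x_{k,n})$, choose a pair of distinct coordinates $I,J$ uniformly at random, independently of the past, and obtain $x_{k+1}$ from $x_k$ by replacing both $x_{k,I}$ and $x_{k,J}$ by $(x_{k,I}+x_{k,J})/2$, keeping all other coordinates the same. Let $\bar{x}_0=\frac1n\sum_{i=1}^n x_{0,i}=\frac1n$, and let $T(k)=\sum_{i=1}^n |x_{k,i}-\bar{x}_0|$. Then, as $n\to\infty$ (with $\log$ the natural logarithm, and a time that is negative read as $0$), $$T(\lfloor \theta n\log n\rfloor)\to 2 \text{ in probability, for every real } \theta<\frac{1}{2\log 2},$$ and $$T(\lfloor \theta n\log n\rfloor)\to 0 \text{ in probability, for every real } \theta>\frac{1}{2\log 2}.$$ That is, the $L^1$ distance to equilibrium has a sharp cutoff at time $\frac12 n\log_2 n$. -/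

import Mathlib

open Filter Topology MeasureTheory ProbabilityTheory

namespace RepeatedAverages

/-- Replace both `x i` and `x j` by their average, keeping all other coordinates. -/
noncomputable def average {n : ℕ} (x : Fin n → ℝ) (i j : Fin n) : Fin n → ℝ :=
  fun l => if l = i ∨ l = j then (x i + x j) / 2 else x l

/-- The state after `k` averaging steps from `x₀`, when the pair of coordinates chosen at the
step from time `k` to time `k + 1` is `p k`. -/
noncomputable def state {n : ℕ} (x₀ : Fin n → ℝ) (p : ℕ → Fin n × Fin n) : ℕ → Fin n → ℝ
  | 0 => x₀
  | k + 1 => average (state x₀ p k) (p k).1 (p k).2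

/-- The initial vector `(1, 0, …, 0)`. -/
noncomputable def unitMass (n : ℕ) : Fin n → ℝ :=
  fun i => if (i : ℕ) = 0 then 1 else 0

/-- `T(k) = ∑ i, |x_{k,i} - x̄₀|`, where `x̄₀` is the mean of the initial vector `x₀`. -/
noncomputable def T {n : ℕ} (x₀ : Fin n → ℝ) (p : ℕ → Fin n × Fin n) (k : ℕ) : ℝ :=
  ∑ i, |state x₀ p k i - (∑ j, x₀ j) / n|

/-- On the probability space `(Ω, μ)`, the random pairs `p 0, p 1, …` are independent, and each
is uniformly distributed over the pairs of distinct coordinates. -/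
structure IsUniformPairs {n : ℕ} {Ω : Type*} [MeasurableSpace Ω] (μ : Measure Ω)
    (p : ℕ → Ω → Fin n × Fin n) : Prop where
  isProbabilityMeasure : IsProbabilityMeasure μ
  measurable : ∀ k, Measurable (p k)
  map_eq : ∀ k, μ.map (p k) = uniformOn {q : Fin n × Fin n | q.1 ≠ q.2}
  indep : iIndepFun p μ

/-- Convergence in probability to a constant, the `n`-th random variable living on its own
probability space `(Ω n, μ n)`. -/
def ConvergesInProbability {Ω : ℕ → Type*} [∀ n, MeasurableSpace (Ω n)]
    (μ : ∀ n, Measure (Ω n)) (Y : ∀ n, Ω n → ℝ) (c : ℝ) : Prop :=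
  ∀ ε : ℝ, 0 < ε → Tendsto (fun n => μ n {ω | ε ≤ |Y n ω - c|}) atTop (𝓝 0)

end RepeatedAverages

/-!
# Cutoff for repeated averages

The whole argument runs on power sums `∑ l, |x l| ^ r` with `r` close to `1`, and on the transition
operator `transition`, whose iterates compute expectations along the chain
(`IsUniformPairs.lintegral_state`); each convergence then follows from Markov's inequality.

*Before the critical time.* Let `0 < s < 1`. By subadditivity of `t ↦ t ^ (1 - s)`, a step multiplies
the mean power sum of exponent `1 - s` by at most `1 + 2 (2 ^ s - 1) / n`, so at time `θ n log n` it is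
at most `n ^ (2 θ (2 ^ s - 1))`. On the other hand `2 - T ≤ 2 n ^ (-s) ∑ l, |x l| ^ (1 - s)`
(`abs_T_sub_two_le`). As `(2 ^ s - 1) / s → log 2`, the product vanishes for small `s` when
`2 θ log 2 < 1`.

*After the critical time.* The power sum of exponent `1 + s` is multiplied in mean by
`1 - 2 (1 - 2 ^ (-s)) / n`, up to an additive error of order `n ^ (-1 - s)`: indeed
`(a + b) ^ (1 + s) ≤ a ^ (1 + s) + b ^ (1 + s) + a b ^ s + b a ^ s`, and the mixed products are small
once summed, as the total mass is one (`transition_powerSum_one_add_le`). Hence, for small `s`, it is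
of the order `n ^ (-s)` of its equilibrium value at a time `θ' n log n` with `θ'` between the critical
value and `θ`. Put `η = (θ - θ') / 4`. Coordinates above `n ^ (η - 1)` then carry a mass of order `n ^ (-η s)`, and their
contribution to the `L¹` deviation stays of that order. The rest of the state has sum of squares at
most `n ^ (η - 1)`, and since averaging is linear it can be followed separately: its centred sum of
squares contracts by `1 - 1 / n` per step, so that `4 η n log n` further steps make its `L¹` deviation
vanish (`transition_iterate_add_deviation_le`).

Signs play no role: all bounds use absolute values, together with the invariance of the sum and
the monotonicity of the `L¹` norm under averaging.
-/

namespace RepeatedAverages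

/-! ### The one-step transition operator -/

/-- The transition operator of the chain: the mean of `f` over the states reachable from `x` in one
step, the pair of distinct coordinates being an ordered one. -/
noncomputable def transition {n : ℕ} (f : (Fin n → ℝ) → ℝ) (x : Fin n → ℝ) : ℝ :=
  (∑ q ∈ (Finset.univ : Finset (Fin n)).offDiag, f (average x q.1 q.2)) / (n * (n - 1))

lemma card_offDiag_fin {n : ℕ} (hn : 2 ≤ n) :
    (((Finset.univ : Finset (Fin n)).offDiag.card : ℕ) : ℝ) = n * (n - 1) := by
  rw [Finset.offDiag_card, Finset.card_univ, Fintype.card_fin, Nat.cast_sub (by nlinarith)]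
  push_cast
  ring

lemma pair_count_pos {n : ℕ} (hn : 2 ≤ n) : (0 : ℝ) < n * (n - 1) := by
  have : (2 : ℝ) ≤ n := by exact_mod_cast hn
  apply mul_pos <;> linarith

lemma transition_mono {n : ℕ} (hn : 2 ≤ n) {f g : (Fin n → ℝ) → ℝ} {x : Fin n → ℝ}
    (h : ∀ i j, i ≠ j → f (average x i j) ≤ g (average x i j)) :
    transition f x ≤ transition g x := by
  unfold transition
  have := pair_count_pos hn
  gcongr with q hq
  exact h _ _ (Finset.mem_offDiag.1 hq).2.2

lemma transition_affine {n : ℕ} (hn : 2 ≤ n) (f : (Fin n → ℝ) → ℝ) (x : Fin n → ℝ) (a b : ℝ) :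
    transition (fun y => a * f y + b) x = a * transition f x + b := by
  unfold transition
  have := pair_count_pos hn
  rw [Finset.sum_add_distrib, ← Finset.mul_sum, Finset.sum_const, nsmul_eq_mul,
    card_offDiag_fin hn, add_div, mul_div_assoc, mul_div_cancel_left₀ _ this.ne']

lemma transition_nonneg {n : ℕ} (hn : 2 ≤ n) {f : (Fin n → ℝ) → ℝ} (hf : ∀ x, 0 ≤ f x)
    (x : Fin n → ℝ) : 0 ≤ transition f x :=
  div_nonneg (Finset.sum_nonneg fun _ _ => hf _) (pair_count_pos hn).le

lemma transition_iterate_nonneg {n : ℕ} (hn : 2 ≤ n) {f : (Fin n → ℝ) → ℝ} (hf : ∀ x, 0 ≤ f x)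
    (k : ℕ) (x : Fin n → ℝ) : 0 ≤ transition^[k] f x := by
  induction k generalizing x with
  | zero => exact hf x
  | succ k ih =>
    rw [Function.iterate_succ_apply']
    exact transition_nonneg hn ih x

/-- An affine one-step bound on a set closed under averaging can be iterated. -/
lemma transition_iterate_le {n : ℕ} (hn : 2 ≤ n) {S : Set (Fin n → ℝ)}
    (hS : ∀ x ∈ S, ∀ i j, i ≠ j → average x i j ∈ S) {f : (Fin n → ℝ) → ℝ} {ρ b : ℝ} (hρ : 0 ≤ ρ)
    (h : ∀ x ∈ S, transition f x ≤ ρ * f x + b) (k : ℕ) :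
    ∀ x ∈ S, transition^[k] f x ≤ ρ ^ k * f x + b * ∑ i ∈ Finset.range k, ρ ^ i := by
  induction k with
  | zero => intro x _; simp
  | succ k ih =>
    intro x hx
    rw [Function.iterate_succ_apply']
    calc transition (transition^[k] f) x
        ≤ transition (fun y => ρ ^ k * f y + b * ∑ i ∈ Finset.range k, ρ ^ i) x :=
          transition_mono hn fun i j hij => ih _ (hS x hx i j hij)
      _ = ρ ^ k * transition f x + b * ∑ i ∈ Finset.range k, ρ ^ i := transition_affine hn ..
      _ ≤ ρ ^ k * (ρ * f x + b) + b * ∑ i ∈ Finset.range k, ρ ^ i := by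
          gcongr
          exact h x hx
      _ = _ := by rw [Finset.sum_range_succ, pow_succ]; ring

lemma transition_iterate_mono {n : ℕ} (hn : 2 ≤ n) {S : Set (Fin n → ℝ)}
    (hS : ∀ x ∈ S, ∀ i j, i ≠ j → average x i j ∈ S) {f g : (Fin n → ℝ) → ℝ}
    (h : ∀ x ∈ S, f x ≤ g x) (k : ℕ) :
    ∀ x ∈ S, transition^[k] f x ≤ transition^[k] g x := by
  induction k with
  | zero => exact h
  | succ k ih =>
    intro x hx
    rw [Function.iterate_succ_apply', Function.iterate_succ_apply']
    exact transition_mono hn fun i j hij => ih _ (hS x hx i j hij)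

lemma transition_iterate_affine {n : ℕ} (hn : 2 ≤ n) (f : (Fin n → ℝ) → ℝ) (a b : ℝ) (k : ℕ) :
    transition^[k] (fun y => a * f y + b) = fun x => a * transition^[k] f x + b := by
  induction k with
  | zero => rfl
  | succ k ih =>
    funext x
    rw [Function.iterate_succ_apply', Function.iterate_succ_apply', ih, transition_affine hn]

/-- Averaging is linear in the state. -/
lemma average_add {n : ℕ} (x y : Fin n → ℝ) (i j : Fin n) :
    average (x + y) i j = average x i j + average y i j := by
  funext l
  simp only [average, Pi.add_apply]
  split_ifs <;> ring

lemma transition_iterate_subadditive {n : ℕ} (hn : 2 ≤ n) {f : (Fin n → ℝ) → ℝ}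
    (h : ∀ x y, f (x + y) ≤ f x + f y) (k : ℕ) :
    ∀ x y, transition^[k] f (x + y) ≤ transition^[k] f x + transition^[k] f y := by
  induction k with
  | zero => exact h
  | succ k ih =>
    intro x y
    simp only [Function.iterate_succ_apply']
    unfold transition
    rw [← add_div, ← Finset.sum_add_distrib]
    have := pair_count_pos hn
    gcongr with q hq
    rw [average_add]
    exact ih _ _

/-! ### Additive functionals of the state -/

lemma sum_comp_average {n : ℕ} (h : ℝ → ℝ) (x : Fin n → ℝ) {i j : Fin n} (hij : i ≠ j) :
    ∑ l, h (average x i j l) =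
      ∑ l, h (x l) + (2 * h ((x i + x j) / 2) - (h (x i) + h (x j))) := by
  have key : ∀ l, h (average x i j l) = h (x l)
      + (if l = i then h ((x i + x j) / 2) - h (x i) else 0)
      + (if l = j then h ((x i + x j) / 2) - h (x j) else 0) := by
    intro l
    by_cases h1 : l = i
    · subst h1; simp [average, hij]
    · by_cases h2 : l = j
      · subst h2; simp [average, h1]
      · simp [average, h1, h2]
  simp only [key, Finset.sum_add_distrib, Finset.sum_ite_eq', Finset.mem_univ, if_true]
  ring

lemma average_self {n : ℕ} (x : Fin n → ℝ) (i : Fin n) : average x i i = x := by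
  funext l
  by_cases h : l = i <;> simp [average, h]

lemma sum_average {n : ℕ} (x : Fin n → ℝ) (i j : Fin n) :
    ∑ l, average x i j l = ∑ l, x l := by
  rcases eq_or_ne i j with rfl | hij
  · rw [average_self]
  · rw [sum_comp_average (fun t => t) x hij]
    ring

lemma sum_abs_average_le {n : ℕ} (x : Fin n → ℝ) (i j : Fin n) :
    ∑ l, |average x i j l| ≤ ∑ l, |x l| := by
  rcases eq_or_ne i j with rfl | hij
  · rw [average_self]
  · rw [sum_comp_average (fun t => |t|) x hij, abs_div, abs_two]
    linarith [abs_add_le (x i) (x j)]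

lemma sum_offDiag {n : ℕ} (F : Fin n × Fin n → ℝ) :
    ∑ q ∈ (Finset.univ : Finset (Fin n)).offDiag, F q = ∑ i, ∑ j, F (i, j) - ∑ i, F (i, i) := by
  have h : ∑ i, ∑ j, F (i, j) = ∑ q ∈ (Finset.univ : Finset (Fin n)) ×ˢ Finset.univ, F q :=
    (Finset.sum_product _ _ _).symm
  rw [h, ← Finset.diag_union_offDiag, Finset.sum_union (Finset.disjoint_diag_offDiag _),
    Finset.sum_diag]
  ring

/-- If the value of `h` at a midpoint is controlled by its values at the endpoints with factor `c`,
up to an interaction term `r`, then a step multiplies the mean of `∑ l, h (x l)` by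
`1 + 2 (c - 1) / n`, up to the mean interaction over the pairs of distinct coordinates. -/
lemma transition_sum_le {n : ℕ} (hn : 2 ≤ n) (h : ℝ → ℝ) (r : ℝ → ℝ → ℝ) (c R : ℝ)
    (x : Fin n → ℝ)
    (hr : ∀ a b, 2 * h ((a + b) / 2) ≤ c * (h a + h b) + r a b)
    (hR : ∑ q ∈ (Finset.univ : Finset (Fin n)).offDiag, r (x q.1) (x q.2) ≤ R) :
    transition (fun y => ∑ l, h (y l)) x ≤
      (1 + 2 * (c - 1) / n) * (∑ l, h (x l)) + R / (n * (n - 1)) := by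
  have hpos := pair_count_pos hn
  have hn0 : (0 : ℝ) < n := by positivity
  have hends : ∑ q ∈ (Finset.univ : Finset (Fin n)).offDiag, (h (x q.1) + h (x q.2)) =
      2 * (n - 1) * ∑ l, h (x l) := by
    rw [sum_offDiag]
    simp only [Finset.sum_add_distrib, Finset.sum_const, Finset.card_univ, Fintype.card_fin,
      nsmul_eq_mul, ← Finset.mul_sum]
    ring
  have hsum : ∑ q ∈ (Finset.univ : Finset (Fin n)).offDiag, ∑ l, h (average x q.1 q.2 l) ≤
      n * (n - 1) * (∑ l, h (x l)) + (c - 1) * (2 * (n - 1) * ∑ l, h (x l)) + R := by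
    calc _ ≤ ∑ q ∈ (Finset.univ : Finset (Fin n)).offDiag,
          ((∑ l, h (x l)) + (c - 1) * (h (x q.1) + h (x q.2)) + r (x q.1) (x q.2)) := by
          refine Finset.sum_le_sum fun q hq => ?_
          rw [sum_comp_average h x (Finset.mem_offDiag.1 hq).2.2]
          linarith [hr (x q.1) (x q.2)]
      _ ≤ _ := by
          rw [Finset.sum_add_distrib, Finset.sum_add_distrib, ← Finset.mul_sum, hends,
            Finset.sum_const, nsmul_eq_mul, card_offDiag_fin hn]
          linarith
  unfold transition
  rw [div_le_iff₀ hpos]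
  refine hsum.trans (le_of_eq ?_)
  have : (n : ℝ) - 1 ≠ 0 := fun h0 => by simp [h0] at hpos
  field_simp

/-! ### Expectations along the chain -/

lemma state_congr {n : ℕ} (x₀ : Fin n → ℝ) {p p' : ℕ → Fin n × Fin n} {k : ℕ}
    (h : ∀ i < k, p i = p' i) : state x₀ p k = state x₀ p' k := by
  induction k with
  | zero => rfl
  | succ k ih =>
    rw [state, state, ih fun i hi => h i (by omega), h k (by omega)]

/-- The state at time `k` is a function of the tuple of the first `k` pairs, which takes values in
a finite discrete space. -/
lemma exists_state_eq_comp {n : ℕ} (hn : 2 ≤ n) (x₀ : Fin n → ℝ) (k : ℕ) :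
    ∃ F : ((Finset.range k) → Fin n × Fin n) → Fin n → ℝ,
      ∀ p : ℕ → Fin n × Fin n, state x₀ p k = F fun i => p i := by
  let q₀ : Fin n × Fin n := (⟨0, by omega⟩, ⟨0, by omega⟩)
  refine ⟨fun v => state x₀ (fun i => if h : i ∈ Finset.range k then v ⟨i, h⟩ else q₀) k,
    fun p => state_congr x₀ fun i hi => ?_⟩
  simp [hi]

section Expectation

variable {n : ℕ} {Ω : Type*} [MeasurableSpace Ω] {μ : Measure Ω} {p : ℕ → Ω → Fin n × Fin n}

lemma IsUniformPairs.measurable_state (hp : IsUniformPairs μ p) (hn : 2 ≤ n) (x₀ : Fin n → ℝ)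
    (f : (Fin n → ℝ) → ENNReal) (k : ℕ) :
    Measurable fun ω => f (state x₀ (fun i => p i ω) k) := by
  obtain ⟨F, hF⟩ := exists_state_eq_comp hn x₀ k
  simp only [hF]
  exact (Measurable.of_discrete (f := fun v => f (F v))).comp
    (measurable_pi_lambda _ fun i => hp.measurable i)

/-- The pair chosen at time `k` is independent of the state at time `k`. -/
lemma IsUniformPairs.indepFun_state (hp : IsUniformPairs μ p) (hn : 2 ≤ n) (x₀ : Fin n → ℝ)
    (f : (Fin n → ℝ) → ENNReal) (g : Fin n × Fin n → ENNReal) (k : ℕ) :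
    IndepFun (fun ω => g (p k ω)) (fun ω => f (state x₀ (fun i => p i ω) k)) μ := by
  obtain ⟨F, hF⟩ := exists_state_eq_comp hn x₀ k
  have h := hp.indep.indepFun_finset {k} (Finset.range k) (by simp) hp.measurable
  simp only [hF]
  exact h.comp (φ := fun v => g (v ⟨k, by simp⟩)) (ψ := fun v => f (F v))
    Measurable.of_discrete Measurable.of_discrete

lemma IsUniformPairs.measure_eq (hp : IsUniformPairs μ p) (hn : 2 ≤ n) (k : ℕ)
    (q : Fin n × Fin n) :
    μ {ω | p k ω = q} = if q.1 ≠ q.2 then ENNReal.ofReal (n * (n - 1))⁻¹ else 0 := by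
  have hset : {q : Fin n × Fin n | q.1 ≠ q.2} =
      ((Finset.univ : Finset (Fin n)).offDiag : Set (Fin n × Fin n)) := by
    ext q; simp
  have hmap : μ {ω | p k ω = q} = μ.map (p k) {q} :=
    (Measure.map_apply (hp.measurable k) (measurableSet_singleton q)).symm
  rw [hmap, hp.map_eq k, hset, ← Finset.coe_singleton, uniformOn_apply_finset]
  split_ifs with hq
  · rw [Finset.inter_singleton_of_mem (by simpa using hq), Finset.card_singleton,
      ENNReal.ofReal_inv_of_pos (pair_count_pos hn), ← card_offDiag_fin hn,
      ENNReal.ofReal_natCast, Nat.cast_one, one_div]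
  · rw [Finset.inter_singleton_of_notMem (by simpa using hq)]
    simp

/-- The Markov property in expectation: a step of the chain applies the transition operator. -/
lemma IsUniformPairs.lintegral_state_succ (hp : IsUniformPairs μ p) (hn : 2 ≤ n)
    (x₀ : Fin n → ℝ) {f : (Fin n → ℝ) → ℝ} (hf : ∀ x, 0 ≤ f x) (k : ℕ) :
    ∫⁻ ω, ENNReal.ofReal (f (state x₀ (fun i => p i ω) (k + 1))) ∂μ =
      ∫⁻ ω, ENNReal.ofReal (transition f (state x₀ (fun i => p i ω) k)) ∂μ := by
  have hsplit : ∀ ω, ENNReal.ofReal (f (state x₀ (fun i => p i ω) (k + 1))) =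
      ∑ q : Fin n × Fin n, (if p k ω = q then 1 else 0) *
        ENNReal.ofReal (f (average (state x₀ (fun i => p i ω) k) q.1 q.2)) := by
    intro ω
    simp [state]
  have htrans : ∀ x : Fin n → ℝ, ENNReal.ofReal (transition f x) =
      ∑ q : Fin n × Fin n, (if q.1 ≠ q.2 then ENNReal.ofReal (n * (n - 1))⁻¹ else 0) *
        ENNReal.ofReal (f (average x q.1 q.2)) := by
    intro x
    have hoff : (Finset.univ : Finset (Fin n)).offDiag =
        (Finset.univ : Finset (Fin n × Fin n)).filter fun q => q.1 ≠ q.2 := by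
      ext q; simp
    rw [transition, div_eq_inv_mul, ENNReal.ofReal_mul (inv_nonneg.2 (pair_count_pos hn).le),
      ENNReal.ofReal_sum_of_nonneg fun _ _ => hf _, Finset.mul_sum, hoff, Finset.sum_filter]
    refine Finset.sum_congr rfl fun q _ => ?_
    split_ifs <;> simp
  simp only [hsplit, htrans]
  have hmeas : ∀ (g : Fin n × Fin n → ENNReal), Measurable fun ω => g (p k ω) := fun g =>
    (Measurable.of_discrete (f := g)).comp (hp.measurable k)
  rw [lintegral_finsetSum, lintegral_finsetSum]
  · refine Finset.sum_congr rfl fun q _ => ?_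
    have hF := hp.measurable_state hn x₀ (fun x => ENNReal.ofReal (f (average x q.1 q.2))) k
    have hg := hmeas fun q' => if q' = q then 1 else 0
    rw [lintegral_mul_eq_lintegral_mul_lintegral_of_indepFun'' hg.aemeasurable hF.aemeasurable
      (hp.indepFun_state hn x₀ (fun x => ENNReal.ofReal (f (average x q.1 q.2)))
        (fun q' => if q' = q then 1 else 0) k), lintegral_const_mul _ hF, ← hp.measure_eq hn k q]
    congr 1
    have hset : MeasurableSet {ω | p k ω = q} := hp.measurable k (measurableSet_singleton q)
    rw [← lintegral_indicator_one hset]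
    refine lintegral_congr fun ω => ?_
    simp [Set.indicator_apply]
  · exact fun q _ => (hp.measurable_state hn x₀
      (fun x => ENNReal.ofReal (f (average x q.1 q.2))) k).const_mul _
  · exact fun q _ => (hmeas fun q' => if q' = q then 1 else 0).mul (hp.measurable_state hn x₀
      (fun x => ENNReal.ofReal (f (average x q.1 q.2))) k)

lemma IsUniformPairs.lintegral_state (hp : IsUniformPairs μ p) (hn : 2 ≤ n)
    (x₀ : Fin n → ℝ) (k : ℕ) {f : (Fin n → ℝ) → ℝ} (hf : ∀ x, 0 ≤ f x) :
    ∫⁻ ω, ENNReal.ofReal (f (state x₀ (fun i => p i ω) k)) ∂μ =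
      ENNReal.ofReal (transition^[k] f x₀) := by
  induction k generalizing f with
  | zero =>
    have := hp.isProbabilityMeasure
    simp [state]
  | succ k ih =>
    rw [hp.lintegral_state_succ hn x₀ hf k, ih (transition_nonneg hn hf),
      Function.iterate_succ_apply]

/-- Markov's inequality along the chain. -/
lemma IsUniformPairs.measure_le (hp : IsUniformPairs μ p) (hn : 2 ≤ n)
    (x₀ : Fin n → ℝ) (k : ℕ) {f : (Fin n → ℝ) → ℝ} (hf : ∀ x, 0 ≤ f x) {ε : ℝ} (hε : 0 < ε) :
    μ {ω | ε ≤ f (state x₀ (fun i => p i ω) k)} ≤ ENNReal.ofReal (transition^[k] f x₀ / ε) := by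
  have h := meas_ge_le_lintegral_div (μ := μ)
    (hp.measurable_state hn x₀ (fun x => ENNReal.ofReal (f x)) k).aemeasurable
    (ε := ENNReal.ofReal ε) (by simpa using hε) ENNReal.ofReal_ne_top
  rw [hp.lintegral_state hn x₀ k hf, ← ENNReal.ofReal_div_of_pos hε] at h
  refine (measure_mono fun ω hω => ?_).trans h
  exact ENNReal.ofReal_le_ofReal hω

end Expectation

/-! ### Power sums -/

/-- The power sum `∑ l, |x l| ^ r`. -/
noncomputable def powerSum {n : ℕ} (r : ℝ) (x : Fin n → ℝ) : ℝ :=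
  ∑ l, |x l| ^ r

lemma powerSum_nonneg {n : ℕ} (r : ℝ) (x : Fin n → ℝ) : 0 ≤ powerSum r x :=
  Finset.sum_nonneg fun _ _ => Real.rpow_nonneg (abs_nonneg _) _

lemma two_mul_abs_midpoint_rpow_le {r : ℝ} (hr : 0 ≤ r) (a b : ℝ) :
    2 * |(a + b) / 2| ^ r ≤ 2 ^ (1 - r) * (|a| + |b|) ^ r := by
  have h : |(a + b) / 2| ≤ (|a| + |b|) / 2 := by
    rw [abs_div, abs_two]
    linarith [abs_add_le a b]
  calc 2 * |(a + b) / 2| ^ r ≤ 2 * ((|a| + |b|) / 2) ^ r := by gcongr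
    _ = 2 ^ (1 - r) * (|a| + |b|) ^ r := by
        rw [Real.div_rpow (by positivity) (by norm_num), Real.rpow_sub (by norm_num),
          Real.rpow_one]
        ring

/-- Below exponent `1`, a step multiplies the power sum by at most `1 + 2 (2 ^ s - 1) / n` in mean;
equality holds when one of the two coordinates chosen is always zero. -/
lemma transition_powerSum_one_sub_le {n : ℕ} (hn : 2 ≤ n) {s : ℝ} (hs0 : 0 ≤ s) (hs1 : s ≤ 1)
    (x : Fin n → ℝ) :
    transition (powerSum (1 - s)) x ≤ (1 + 2 * (2 ^ s - 1) / n) * powerSum (1 - s) x := by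
  have h := transition_sum_le hn (fun t => |t| ^ (1 - s)) (fun _ _ => 0) (2 ^ s) 0 x
    (fun a b => ?_) (by simp)
  · rwa [zero_div, add_zero] at h
  · have h1 := two_mul_abs_midpoint_rpow_le (r := 1 - s) (by linarith) a b
    have h2 := Real.rpow_add_le_add_rpow (p := 1 - s) (abs_nonneg a) (abs_nonneg b)
      (by linarith) (by linarith)
    rw [sub_sub_cancel] at h1
    rw [add_zero]
    exact h1.trans (by gcongr)

/-- The interaction term of the power sum of exponent `1 + s`: averaging two coordinates of which
one is zero divides their contribution by `2 ^ s`, and the rest is a mixed product. -/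
lemma midpoint_rpow_one_add_le {s : ℝ} (hs0 : 0 ≤ s) (hs1 : s ≤ 1) (a b : ℝ) :
    2 * |(a + b) / 2| ^ (1 + s) ≤
      2 ^ (-s) * (|a| ^ (1 + s) + |b| ^ (1 + s)) + (|a| * |b| ^ s + |b| * |a| ^ s) := by
  have h1 := two_mul_abs_midpoint_rpow_le (r := 1 + s) (by linarith) a b
  have h2 := Real.rpow_add_le_add_rpow (p := s) (abs_nonneg a) (abs_nonneg b) hs0 hs1
  have hpow : ∀ t : ℝ, 0 ≤ t → t ^ (1 + s) = t * t ^ s := fun t ht => by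
    rw [Real.rpow_add_of_nonneg ht (by norm_num) hs0, Real.rpow_one]
  have h3 : (2 : ℝ) ^ (-s) ≤ 1 := Real.rpow_le_one_of_one_le_of_nonpos (by norm_num) (by linarith)
  have h4 : (0 : ℝ) ≤ 2 ^ (-s) := by positivity
  have h5 : 0 ≤ |a| * |b| ^ s + |b| * |a| ^ s := by positivity
  rw [show 1 - (1 + s) = -s by ring, hpow (|a| + |b|) (by positivity)] at h1
  rw [hpow _ (abs_nonneg a), hpow _ (abs_nonneg b)]
  calc _ ≤ 2 ^ (-s) * ((|a| + |b|) * (|a| + |b|) ^ s) := h1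
    _ ≤ 2 ^ (-s) * ((|a| + |b|) * (|a| ^ s + |b| ^ s)) := by gcongr
    _ = 2 ^ (-s) * (|a| * |a| ^ s + |b| * |b| ^ s) +
        2 ^ (-s) * (|a| * |b| ^ s + |b| * |a| ^ s) := by ring
    _ ≤ _ := by
        gcongr
        exact mul_le_of_le_one_left h5 h3

lemma powerSum_le_of_sum_abs_le_one {n : ℕ} (hn : 2 ≤ n) {s : ℝ} (hs0 : 0 ≤ s) (hs1 : s ≤ 1)
    {x : Fin n → ℝ} (hx : ∑ l, |x l| ≤ 1) : powerSum s x ≤ 2 * (n : ℝ) ^ (1 - s) := by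
  have hn0 : (0 : ℝ) < n := by positivity
  have hterm : ∀ l, |x l| ^ s ≤ (n : ℝ) ^ (-s) * (1 + n * |x l|) := by
    intro l
    have hb : 0 ≤ |x l| := abs_nonneg _
    have h1 : (n * |x l|) ^ s ≤ 1 + n * |x l| := by
      rcases le_total (n * |x l|) 1 with h | h
      · have := Real.rpow_le_one (by positivity) h hs0
        linarith [mul_nonneg hn0.le hb]
      · have := Real.rpow_le_rpow_of_exponent_le h hs1
        rw [Real.rpow_one] at this
        linarith
    rw [Real.mul_rpow hn0.le hb] at h1
    calc |x l| ^ s = (n : ℝ) ^ (-s) * ((n : ℝ) ^ s * |x l| ^ s) := by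
          rw [← mul_assoc, ← Real.rpow_add hn0]; simp
      _ ≤ _ := by gcongr
  calc powerSum s x ≤ ∑ l, (n : ℝ) ^ (-s) * (1 + n * |x l|) := Finset.sum_le_sum fun l _ => hterm l
    _ = (n : ℝ) ^ (-s) * (n + n * ∑ l, |x l|) := by
        rw [← Finset.mul_sum, Finset.sum_add_distrib, ← Finset.mul_sum]; simp
    _ ≤ (n : ℝ) ^ (-s) * (n + n * 1) := by gcongr
    _ = 2 * (n : ℝ) ^ (1 - s) := by
        rw [sub_eq_neg_add, Real.rpow_add hn0, Real.rpow_one]; ring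

/-- Above exponent `1`, a step multiplies the power sum by `1 - 2 (1 - 2 ^ (-s)) / n` in mean, up
to an error of order `n ^ (-1 - s)` due to pairs of comparable coordinates. -/
lemma transition_powerSum_one_add_le {n : ℕ} (hn : 2 ≤ n) {s : ℝ} (hs0 : 0 ≤ s) (hs1 : s ≤ 1)
    {x : Fin n → ℝ} (hx : ∑ l, |x l| ≤ 1) :
    transition (powerSum (1 + s)) x ≤
      (1 - 2 * (1 - 2 ^ (-s)) / n) * powerSum (1 + s) x + 8 * (n : ℝ) ^ (-s) / n := by
  have hn2 : (2 : ℝ) ≤ n := by exact_mod_cast hn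
  have hn0 : (0 : ℝ) < n := by positivity
  have h := transition_sum_le hn (fun t => |t| ^ (1 + s))
    (fun a b => |a| * |b| ^ s + |b| * |a| ^ s) (2 ^ (-s)) (4 * (n : ℝ) ^ (1 - s)) x
    (midpoint_rpow_one_add_le hs0 hs1) ?_
  · refine h.trans ?_
    have hsum : ∑ l, |x l| ^ (1 + s) = powerSum (1 + s) x := rfl
    rw [hsum]
    have hcoef : (1 + 2 * ((2 : ℝ) ^ (-s) - 1) / n) = 1 - 2 * (1 - 2 ^ (-s)) / n := by ring
    rw [hcoef]
    refine add_le_add_right ?_ _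
    rw [sub_eq_neg_add, Real.rpow_add hn0, Real.rpow_one,
      div_le_div_iff₀ (pair_count_pos hn) hn0]
    have h4 : (0 : ℝ) ≤ (n : ℝ) ^ (-s) := by positivity
    nlinarith [mul_nonneg (mul_nonneg h4 hn0.le) (sub_nonneg.2 hn2)]
  · rw [sum_offDiag]
    have hdiag : 0 ≤ ∑ i, (|x i| * |x i| ^ s + |x i| * |x i| ^ s) :=
      Finset.sum_nonneg fun _ _ => by positivity
    have hfull : ∑ i, ∑ j, (|x i| * |x j| ^ s + |x j| * |x i| ^ s) =
        2 * ((∑ l, |x l|) * powerSum s x) := by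
      rw [powerSum]
      simp only [Finset.sum_add_distrib]
      rw [Finset.sum_comm (f := fun i j => |x j| * |x i| ^ s), Finset.sum_mul_sum]
      ring
    have h1 := powerSum_le_of_sum_abs_le_one hn hs0 hs1 hx
    have h2 : (∑ l, |x l|) * powerSum s x ≤ 1 * (2 * (n : ℝ) ^ (1 - s)) :=
      mul_le_mul hx h1 (powerSum_nonneg _ _) zero_le_one
    simp only [hfull]
    linarith

/-- The mean power sum of exponent `1 + s` decays exponentially until it reaches the order
`n ^ (-s)` of its value at equilibrium. -/
lemma transition_iterate_powerSum_one_add_le {n : ℕ} (hn : 2 ≤ n) {s : ℝ} (hs0 : 0 < s)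
    (hs1 : s ≤ 1) (k : ℕ) {x : Fin n → ℝ} (hx : ∑ l, |x l| ≤ 1) :
    transition^[k] (powerSum (1 + s)) x ≤
      (1 - 2 * (1 - 2 ^ (-s)) / n) ^ k * powerSum (1 + s) x +
        4 / (1 - 2 ^ (-s)) * (n : ℝ) ^ (-s) := by
  have hn2 : (2 : ℝ) ≤ n := by exact_mod_cast hn
  have hn0 : (0 : ℝ) < n := by positivity
  have hlt : (2 : ℝ) ^ (-s) < 1 := Real.rpow_lt_one_of_one_lt_of_neg (by norm_num) (by linarith)
  have hpos : (0 : ℝ) < 2 ^ (-s) := by positivity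
  set γ : ℝ := 1 - 2 ^ (-s) with hγ
  have hγ0 : 0 < γ := by linarith
  have hρ : 0 ≤ 1 - 2 * γ / n := by
    rw [sub_nonneg, div_le_one hn0]
    linarith
  refine (transition_iterate_le hn (S := {y | ∑ l, |y l| ≤ 1})
    (fun y hy i j _ => (sum_abs_average_le y i j).trans hy) hρ
    (fun y hy => transition_powerSum_one_add_le hn hs0.le hs1 hy) k x hx).trans ?_
  refine add_le_add
    (le_refl ((1 - 2 * γ / n) ^ k * powerSum (1 + s) x)) ?_
  have hgeom := mul_neg_geom_sum (1 - 2 * γ / n) k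
  have hle : (2 * γ / n) * ∑ i ∈ Finset.range k, (1 - 2 * γ / n) ^ i ≤ 1 := by
    rw [sub_sub_cancel] at hgeom
    rw [hgeom]
    linarith [pow_nonneg hρ k]
  calc _ = (4 / γ * (n : ℝ) ^ (-s)) *
        ((2 * γ / n) * ∑ i ∈ Finset.range k, (1 - 2 * γ / n) ^ i) := by
        have : 8 * (n : ℝ) ^ (-s) / n = 4 / γ * (n : ℝ) ^ (-s) * (2 * γ / n) := by
          field_simp
          norm_num
        rw [this, mul_assoc]
    _ ≤ (4 / γ * (n : ℝ) ^ (-s)) * 1 := by gcongr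
    _ = _ := mul_one _

/-! ### The `L¹` deviation from the mean -/

/-- The `L¹` distance from `x` to the constant vector with the same mean. -/
noncomputable def deviation {n : ℕ} (x : Fin n → ℝ) : ℝ :=
  ∑ l, |x l - (∑ j, x j) / n|

lemma deviation_nonneg {n : ℕ} (x : Fin n → ℝ) : 0 ≤ deviation x :=
  Finset.sum_nonneg fun _ _ => abs_nonneg _

lemma deviation_add_le {n : ℕ} (x y : Fin n → ℝ) :
    deviation (x + y) ≤ deviation x + deviation y := by
  rw [deviation, deviation, deviation, ← Finset.sum_add_distrib]
  refine Finset.sum_le_sum fun l _ => ?_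
  refine le_trans (le_of_eq ?_) (abs_add_le _ _)
  simp only [Pi.add_apply, Finset.sum_add_distrib]
  congr 1
  ring

lemma deviation_le {n : ℕ} (hn : 2 ≤ n) (x : Fin n → ℝ) : deviation x ≤ ∑ l, 2 * |x l| := by
  have hn0 : (0 : ℝ) < n := by positivity
  calc deviation x ≤ ∑ l, (|x l| + |∑ j, x j| / n) := by
        refine Finset.sum_le_sum fun l _ => (abs_sub _ _).trans_eq ?_
        rw [abs_div, Nat.abs_cast]
    _ = ∑ l, |x l| + |∑ j, x j| := by
        rw [Finset.sum_add_distrib, Finset.sum_const, Finset.card_univ, Fintype.card_fin,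
          nsmul_eq_mul, mul_div_cancel₀ _ hn0.ne']
    _ ≤ _ := by
        rw [← Finset.mul_sum]
        linarith [Finset.abs_sum_le_sum_abs x Finset.univ]

lemma transition_iterate_deviation_le {n : ℕ} (hn : 2 ≤ n) (k : ℕ) (x : Fin n → ℝ) :
    transition^[k] deviation x ≤ 2 * ∑ l, |x l| := by
  have h1 := transition_iterate_mono hn (S := Set.univ) (fun _ _ _ _ _ => Set.mem_univ _)
    (fun y _ => deviation_le hn y) k x (Set.mem_univ _)
  have h2 := transition_iterate_le hn (S := Set.univ) (fun _ _ _ _ _ => Set.mem_univ _)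
    (f := fun y => ∑ l, 2 * |y l|) (ρ := 1) (b := 0) zero_le_one
    (fun y _ => by
      have h := transition_sum_le hn (fun t => 2 * |t|) (fun _ _ => 0) 1 0 y
        (fun a b => by
          rw [abs_div, abs_two]
          linarith [abs_add_le a b]) (by simp)
      simpa using h) k x (Set.mem_univ _)
  rw [Finset.mul_sum]
  simpa using h1.trans h2

/-- The sum of squared deviations from the mean contracts by `1 - 1 / n` in mean, and controls the
`L¹` deviation through the inequality of arithmetic and geometric means with weight `t`. -/
lemma transition_iterate_deviation_le_sum_sq {n : ℕ} (hn : 2 ≤ n) (k : ℕ) (x : Fin n → ℝ) {t : ℝ}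
    (ht : 0 < t) :
    transition^[k] deviation x ≤ n * t * ((1 - 1 / n) ^ k * ∑ l, x l ^ 2) + 1 / t := by
  have hn2 : (2 : ℝ) ≤ n := by exact_mod_cast hn
  have hn0 : (0 : ℝ) < n := by positivity
  set m : ℝ := (∑ l, x l) / n with hm
  let S : Set (Fin n → ℝ) := {y | (∑ l, y l) / n = m}
  have hS : ∀ y ∈ S, ∀ i j, i ≠ j → average y i j ∈ S := fun y hy i j _ => by
    simpa only [S, Set.mem_ofPred_eq, sum_average] using hy
  let V : (Fin n → ℝ) → ℝ := fun y => ∑ l, (y l - m) ^ 2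
  have hdev : ∀ y ∈ S, deviation y ≤ n * t * V y + 1 / t := by
    intro y hy
    have hterm : ∀ d : ℝ, |d| ≤ n * t * d ^ 2 + 1 / t / n := by
      intro d
      have hnt : 0 < n * t := by positivity
      rw [div_div, mul_comm t, ← sq_abs d, ← sub_nonneg]
      have : n * t * |d| ^ 2 + 1 / (n * t) - |d| =
          ((n * t * |d| - 1 / 2) ^ 2 + 3 / 4) / (n * t) := by
        field_simp
        ring
      rw [this]
      positivity
    have hym : (∑ l, y l) / n = m := hy
    calc deviation y = ∑ l, |y l - m| := by rw [deviation, hym]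
      _ ≤ ∑ l, (n * t * (y l - m) ^ 2 + 1 / t / n) := Finset.sum_le_sum fun l _ => hterm _
      _ = _ := by
          rw [Finset.sum_add_distrib, ← Finset.mul_sum, Finset.sum_const, Finset.card_univ,
            Fintype.card_fin, nsmul_eq_mul, mul_div_cancel₀ _ hn0.ne']
  have hV : ∀ y ∈ S, transition V y ≤ (1 - 1 / n) * V y + 0 := by
    intro y hy
    have hym : (∑ l, y l) / n = m := hy
    have h := transition_sum_le hn (fun u => (u - m) ^ 2) (fun a b => (a - m) * (b - m)) (1 / 2) 0
      y (fun a b => le_of_eq (by ring)) ?_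
    · refine h.trans (le_of_eq ?_)
      simp only [V]
      ring
    · -- The deviations sum to zero, so their products over distinct pairs sum to minus `V y`.
      rw [sum_offDiag]
      have hzero : ∑ l, (y l - m) = 0 := by
        rw [Finset.sum_sub_distrib, Finset.sum_const, Finset.card_univ, Fintype.card_fin,
          nsmul_eq_mul, ← hym, mul_div_cancel₀ _ hn0.ne', sub_self]
      simp only [← Finset.mul_sum, hzero, mul_zero, Finset.sum_const_zero, zero_sub,
        Left.neg_nonpos_iff]
      exact Finset.sum_nonneg fun l _ => mul_self_nonneg _
  have hρ : (0 : ℝ) ≤ 1 - 1 / n := by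
    rw [sub_nonneg, div_le_one hn0]
    linarith
  have hxS : x ∈ S := rfl
  have hV0 : V x ≤ ∑ l, x l ^ 2 := by
    have : V x = ∑ l, x l ^ 2 - n * m ^ 2 := by
      have hsum : ∑ l, x l = n * m := by rw [hm, mul_div_cancel₀ _ hn0.ne']
      simp only [V, sub_sq, Finset.sum_add_distrib, Finset.sum_sub_distrib, ← Finset.mul_sum,
        ← Finset.sum_mul, hsum, Finset.sum_const, Finset.card_univ, Fintype.card_fin,
        nsmul_eq_mul]
      ring
    rw [this]
    linarith [mul_nonneg hn0.le (sq_nonneg m)]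
  have h1 := transition_iterate_mono hn hS hdev k x hxS
  have h2 := transition_iterate_le hn hS hρ hV k x hxS
  rw [transition_iterate_affine hn] at h1
  refine h1.trans ?_
  rw [zero_mul, add_zero] at h2
  have h3 : (1 - 1 / (n : ℝ)) ^ k * V x ≤ (1 - 1 / n) ^ k * ∑ l, x l ^ 2 := by gcongr
  have h4 := mul_le_mul_of_nonneg_left (h2.trans h3) (mul_pos hn0 ht).le
  exact add_le_add_left h4 _

/-- Truncation at height `a`: the small coordinates have small sum of squares, and the large ones
carry a mass controlled by the power sum of exponent `1 + s`. -/
lemma exists_truncation {n : ℕ} {x : Fin n → ℝ} (hx : ∑ l, |x l| ≤ 1) {a s : ℝ} (ha : 0 < a)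
    (hs : 0 ≤ s) :
    ∃ y z : Fin n → ℝ, x = y + z ∧ ∑ l, y l ^ 2 ≤ a ∧
      ∑ l, |z l| ≤ a ^ (-s) * powerSum (1 + s) x := by
  refine ⟨fun l => if |x l| ≤ a then x l else 0, fun l => if |x l| ≤ a then 0 else x l, ?_, ?_, ?_⟩
  · funext l
    simp only [Pi.add_apply]
    split_ifs <;> simp
  · calc _ ≤ ∑ l, a * |x l| := by
          refine Finset.sum_le_sum fun l _ => ?_
          dsimp only
          split_ifs with h
          · rw [← sq_abs, sq]
            gcongr
          · rw [zero_pow two_ne_zero]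
            positivity
      _ ≤ a * 1 := by rw [← Finset.mul_sum]; gcongr
      _ = a := mul_one a
  · rw [powerSum, Finset.mul_sum]
    refine Finset.sum_le_sum fun l _ => ?_
    dsimp only
    split_ifs with h
    · rw [abs_zero]
      positivity
    · push Not at h
      have h0 : 0 < |x l| := ha.trans h
      have h1 : 1 ≤ (|x l| / a) ^ s := Real.one_le_rpow ((one_le_div ha).2 h.le) hs
      calc |x l| ≤ |x l| * (|x l| / a) ^ s := le_mul_of_one_le_right h0.le h1
        _ = _ := by
            rw [Real.div_rpow h0.le ha.le, Real.rpow_neg ha.le, Real.rpow_add h0, Real.rpow_one]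
            ring

/-- The two phases combined: `k₁` steps spread the mass, and `k₂` further steps equilibrate the
part of it that lies below height `a`. -/
lemma transition_iterate_add_deviation_le {n : ℕ} (hn : 2 ≤ n) {s : ℝ} (hs0 : 0 < s) (hs1 : s ≤ 1)
    {a t : ℝ} (ha : 0 < a) (ht : 0 < t) (k₁ k₂ : ℕ) {x : Fin n → ℝ} (hx : ∑ l, |x l| ≤ 1) :
    transition^[k₁ + k₂] deviation x ≤
      2 * a ^ (-s) * ((1 - 2 * (1 - 2 ^ (-s)) / n) ^ k₁ * powerSum (1 + s) x +
        4 / (1 - 2 ^ (-s)) * (n : ℝ) ^ (-s)) + (n * t * ((1 - 1 / n) ^ k₂ * a) + 1 / t) := by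
  have hn2 : (2 : ℝ) ≤ n := by exact_mod_cast hn
  have hρ : (0 : ℝ) ≤ 1 - 1 / n := by
    rw [sub_nonneg, div_le_one (by positivity)]
    linarith
  have hsecond : ∀ y ∈ {y : Fin n → ℝ | ∑ l, |y l| ≤ 1}, transition^[k₂] deviation y ≤
      2 * a ^ (-s) * powerSum (1 + s) y + (n * t * ((1 - 1 / n) ^ k₂ * a) + 1 / t) := by
    intro y hy
    obtain ⟨u, v, rfl, hu, hv⟩ := exists_truncation hy ha hs0.le
    have h1 := transition_iterate_subadditive hn deviation_add_le k₂ u v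
    have h2 := transition_iterate_deviation_le_sum_sq hn k₂ u ht
    have h3 := transition_iterate_deviation_le hn k₂ v
    have h4 : n * t * ((1 - 1 / (n : ℝ)) ^ k₂ * ∑ l, u l ^ 2) ≤
        n * t * ((1 - 1 / n) ^ k₂ * a) := by gcongr
    linarith
  rw [Function.iterate_add_apply]
  have h := transition_iterate_mono hn
    (fun y hy i j _ => (sum_abs_average_le y i j).trans hy) hsecond k₁ x hx
  rw [transition_iterate_affine hn] at h
  refine h.trans ?_
  have h1 := transition_iterate_powerSum_one_add_le hn hs0 hs1 k₁ hx
  have h2 : 0 ≤ 2 * a ^ (-s) := by positivity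
  exact add_le_add_left (mul_le_mul_of_nonneg_left h1 h2) _

/-! ### The initial state -/

lemma sum_comp_unitMass {n : ℕ} (hn : 2 ≤ n) {h : ℝ → ℝ} (h0 : h 0 = 0) :
    ∑ l, h (unitMass n l) = h 1 := by
  rw [Finset.sum_eq_single (⟨0, by omega⟩ : Fin n)]
  · simp [unitMass]
  · intro l _ hl
    have : (l : ℕ) ≠ 0 := fun h' => hl (Fin.ext h')
    simp [unitMass, this, h0]
  · simp

lemma sum_unitMass {n : ℕ} (hn : 2 ≤ n) : ∑ l, unitMass n l = 1 :=
  sum_comp_unitMass hn (h := fun t => t) rfl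

lemma sum_abs_unitMass {n : ℕ} (hn : 2 ≤ n) : ∑ l, |unitMass n l| = 1 := by
  simpa using sum_comp_unitMass hn (h := fun t => |t|) abs_zero

lemma powerSum_unitMass {n : ℕ} (hn : 2 ≤ n) {r : ℝ} (hr : 0 < r) :
    powerSum r (unitMass n) = 1 := by
  have := sum_comp_unitMass hn (h := fun t => |t| ^ r) (by simp [hr.ne'])
  simpa [powerSum] using this

lemma sum_state {n : ℕ} (x₀ : Fin n → ℝ) (p : ℕ → Fin n × Fin n) (k : ℕ) :
    ∑ l, state x₀ p k l = ∑ l, x₀ l := by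
  induction k with
  | zero => rfl
  | succ k ih => rw [state, sum_average, ih]

lemma sum_abs_state_le {n : ℕ} (x₀ : Fin n → ℝ) (p : ℕ → Fin n × Fin n) (k : ℕ) :
    ∑ l, |state x₀ p k l| ≤ ∑ l, |x₀ l| := by
  induction k with
  | zero => rfl
  | succ k ih => exact (sum_abs_average_le _ _ _).trans ih

lemma T_eq_deviation {n : ℕ} (x₀ : Fin n → ℝ) (p : ℕ → Fin n × Fin n) (k : ℕ) :
    T x₀ p k = deviation (state x₀ p k) := by
  rw [T, deviation, sum_state]

/-- The gap `2 - T` is twice the sum of `min |x l| (1 / n)`, and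
`min |x l| (1 / n) ≤ n ^ (-s) * |x l| ^ (1 - s)`. -/
lemma abs_T_sub_two_le {n : ℕ} (hn : 2 ≤ n) {s : ℝ} (hs0 : 0 ≤ s) (hs1 : s ≤ 1)
    (p : ℕ → Fin n × Fin n) (k : ℕ) :
    |T (unitMass n) p k - 2| ≤
      2 * (n : ℝ) ^ (-s) * powerSum (1 - s) (state (unitMass n) p k) := by
  have hn0 : (0 : ℝ) < n := by positivity
  have hle : T (unitMass n) p k ≤ 2 := by
    rw [T_eq_deviation]
    refine (deviation_le hn _).trans ?_
    rw [← Finset.mul_sum]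
    linarith [(sum_abs_state_le (unitMass n) p k).trans_eq (sum_abs_unitMass hn)]
  set x := state (unitMass n) p k with hx
  have hsum : 1 ≤ ∑ l, |x l| := by
    have h1 : ∑ l, x l = 1 := (sum_state _ p k).trans (sum_unitMass hn)
    rw [← h1]
    exact Finset.sum_le_sum fun l _ => le_abs_self _
  have hterm : ∀ b : ℝ, |b| + 1 / n - 2 * ((n : ℝ) ^ (-s) * |b| ^ (1 - s)) ≤ |b - 1 / n| := by
    intro b
    have hd : (0 : ℝ) < 1 / n := by positivity
    have hns : (n : ℝ) ^ (-s) = (1 / (n : ℝ)) ^ s := by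
      rw [Real.rpow_neg hn0.le, one_div, Real.inv_rpow hn0.le]
    rw [hns]
    have habs := abs_abs_sub_abs_le_abs_sub b (1 / n)
    rw [abs_of_pos hd] at habs
    have hsplit : ∀ u : ℝ, 0 ≤ u → u ^ s * u ^ (1 - s) = u := fun u hu => by
      rw [← Real.rpow_add_of_nonneg hu hs0 (by linarith), add_sub_cancel, Real.rpow_one]
    rcases le_total |b| (1 / n) with h | h
    · have h1 : |b| ≤ (1 / (n : ℝ)) ^ s * |b| ^ (1 - s) := by
        calc |b| = |b| ^ s * |b| ^ (1 - s) := (hsplit _ (abs_nonneg b)).symm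
          _ ≤ _ := by gcongr
      linarith [neg_le_abs (|b| - 1 / n)]
    · have h1 : 1 / (n : ℝ) ≤ (1 / (n : ℝ)) ^ s * |b| ^ (1 - s) := by
        calc 1 / (n : ℝ) = (1 / (n : ℝ)) ^ s * (1 / (n : ℝ)) ^ (1 - s) := (hsplit _ hd.le).symm
          _ ≤ _ := by gcongr
      linarith [le_abs_self (|b| - 1 / n)]
  have hge : 2 - 2 * (n : ℝ) ^ (-s) * powerSum (1 - s) x ≤ T (unitMass n) p k := by
    rw [T, sum_unitMass hn, ← hx]
    refine le_trans ?_ (Finset.sum_le_sum fun l _ => hterm (x l))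
    rw [Finset.sum_sub_distrib, Finset.sum_add_distrib, ← Finset.mul_sum, ← Finset.mul_sum,
      Finset.sum_const, Finset.card_univ, Fintype.card_fin, nsmul_eq_mul,
      mul_div_cancel₀ _ hn0.ne', powerSum]
    linarith
  rw [abs_of_nonpos (by linarith)]
  linarith

/-! ### Choice of exponents and limits -/

/-- The exponent exists because `(2 ^ s - 1) / s → log 2` as `s → 0`. -/
lemma exists_exponent_of_subcritical {θ : ℝ} (hθ0 : 0 ≤ θ) (hθ : θ < 1 / (2 * Real.log 2)) :
    ∃ s : ℝ, 0 < s ∧ s < 1 ∧ 2 * θ * (2 ^ s - 1) < s := by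
  have hlog : 0 < Real.log 2 := Real.log_pos (by norm_num)
  have hlog1 : Real.log 2 < 1 := Real.log_two_lt_d9.trans (by norm_num)
  rw [lt_div_iff₀ (by positivity)] at hθ
  set κ := θ * (2 * Real.log 2) with hκ
  have hκ0 : 0 ≤ κ := by positivity
  have hs : 0 < (1 - κ) / 2 := by linarith
  refine ⟨(1 - κ) / 2, hs, by linarith, ?_⟩
  set s := (1 - κ) / 2 with hsdef
  have hu : |Real.log 2 * s| ≤ 1 := by
    rw [abs_of_pos (by positivity)]
    nlinarith
  have hexp := (abs_le.1 (Real.abs_exp_sub_one_sub_id_le hu)).2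
  rw [Real.rpow_def_of_pos (by norm_num)]
  have h1 : Real.exp (Real.log 2 * s) - 1 ≤ Real.log 2 * s * (1 + s) := by
    have : Real.log 2 * s * (Real.log 2 * s) ≤ Real.log 2 * s * (1 * s) := by gcongr
    nlinarith
  calc 2 * θ * (Real.exp (Real.log 2 * s) - 1) ≤ 2 * θ * (Real.log 2 * s * (1 + s)) := by gcongr
    _ = κ * (1 + s) * s := by rw [hκ]; ring
    _ < 1 * s := by
        gcongr
        nlinarith
    _ = s := one_mul s

/-- The exponent exists because `(1 - 2 ^ (-s)) / s → log 2` as `s → 0`. -/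
lemma exists_exponent_of_supercritical {θ : ℝ} (hθ : 1 / (2 * Real.log 2) < θ) :
    ∃ s : ℝ, 0 < s ∧ s ≤ 1 ∧ s ≤ 2 * (1 - 2 ^ (-s)) * θ := by
  have hlog : 0 < Real.log 2 := Real.log_pos (by norm_num)
  have hlog1 : Real.log 2 < 1 := Real.log_two_lt_d9.trans (by norm_num)
  have hθ0 : 0 < θ := lt_trans (by positivity) hθ
  rw [div_lt_iff₀ (by positivity)] at hθ
  set κ := θ * (2 * Real.log 2) with hκ
  have hinv : κ⁻¹ < 1 := inv_lt_one_of_one_lt₀ hθ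
  have hinv0 : 0 < κ⁻¹ := by positivity
  have hs : 0 < 1 - κ⁻¹ := by linarith
  refine ⟨1 - κ⁻¹, hs, by linarith, ?_⟩
  set s := 1 - κ⁻¹ with hsdef
  have hκs : κ * (1 - s) = 1 := by
    rw [hsdef, sub_sub_cancel, mul_inv_cancel₀ (by positivity)]
  have hs1 : s < 1 := by linarith
  have hu : |Real.log 2 * -s| ≤ 1 := by
    rw [abs_le]
    constructor <;> nlinarith
  have hexp := (abs_le.1 (Real.abs_exp_sub_one_sub_id_le hu)).2
  rw [Real.rpow_def_of_pos (by norm_num)]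
  have h1 : Real.log 2 * s * (1 - s) ≤ 1 - Real.exp (Real.log 2 * -s) := by
    have : Real.log 2 * s * (Real.log 2 * s) ≤ Real.log 2 * s * (1 * s) := by gcongr
    nlinarith
  calc s = κ * (1 - s) * s := by rw [hκs, one_mul]
    _ = 2 * (Real.log 2 * s * (1 - s)) * θ := by rw [hκ]; ring
    _ ≤ _ := by gcongr

lemma one_sub_div_pow_le {n : ℕ} (hn : 2 ≤ n) {γ τ : ℝ} (hγ0 : 0 ≤ γ) (hγ : γ ≤ 2) {k : ℕ}
    (hk : τ * n * Real.log n - 1 ≤ k) :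
    (1 - γ / n) ^ k ≤ Real.exp γ * (n : ℝ) ^ (-(γ * τ)) := by
  have hn2 : (2 : ℝ) ≤ n := by exact_mod_cast hn
  have hn0 : (0 : ℝ) < n := by positivity
  have hρ : 0 ≤ 1 - γ / n := by
    rw [sub_nonneg, div_le_one hn0]
    linarith
  calc (1 - γ / n) ^ k ≤ Real.exp (-(γ / n)) ^ k := by
        gcongr
        linarith [Real.add_one_le_exp (-(γ / n))]
    _ = Real.exp (-(γ / n * k)) := by rw [← Real.exp_nat_mul]; ring_nf
    _ ≤ Real.exp (γ + Real.log n * -(γ * τ)) := by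
        gcongr
        have h1 : γ / n * (τ * n * Real.log n - 1) ≤ γ / n * k := by gcongr
        have h2 : γ / n * (τ * n * Real.log n - 1) = γ * τ * Real.log n - γ / n := by
          field_simp
        have h3 : γ / n ≤ γ := div_le_self hγ0 (by linarith)
        linarith
    _ = _ := by rw [Real.exp_add, Real.rpow_def_of_pos hn0]

lemma tendsto_natCast_rpow_neg {r : ℝ} (hr : 0 < r) :
    Tendsto (fun n : ℕ => (n : ℝ) ^ (-r)) atTop (𝓝 0) :=
  (tendsto_rpow_neg_atTop hr).comp tendsto_natCast_atTop_atTop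

/-- Before the critical time, the mean of the bound `2 n ^ (-s) ∑ l, |x l| ^ (1 - s)` on `2 - T`
tends to zero. A negative `θ` gives time `0`, like `θ = 0`, hence the `max θ 0`. -/
lemma tendsto_transition_powerSum {θ s : ℝ} (hs0 : 0 < s) (hs1 : s < 1)
    (h : 2 * max θ 0 * (2 ^ s - 1) < s) :
    Tendsto (fun n : ℕ => 2 * (n : ℝ) ^ (-s) *
      transition^[⌊θ * n * Real.log n⌋₊] (powerSum (1 - s)) (unitMass n)) atTop (𝓝 0) := by
  set τ := max θ 0 with hτ
  have hlim := (tendsto_natCast_rpow_neg (sub_pos.2 h)).const_mul 2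
  rw [mul_zero] at hlim
  refine tendsto_of_tendsto_of_tendsto_of_le_of_le' tendsto_const_nhds hlim ?_ ?_
  · filter_upwards [eventually_ge_atTop 2] with n hn
    have := transition_iterate_nonneg hn (powerSum_nonneg (1 - s)) ⌊θ * n * Real.log n⌋₊
      (unitMass n)
    positivity
  · filter_upwards [eventually_ge_atTop 2] with n hn
    have hn2 : (2 : ℝ) ≤ n := by exact_mod_cast hn
    have hn0 : (0 : ℝ) < n := by positivity
    have hL : 0 ≤ Real.log n := Real.log_nonneg (by linarith)
    have hτ0 : 0 ≤ τ := le_max_right _ _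
    have hβ : (0 : ℝ) ≤ 2 ^ s - 1 := by
      linarith [Real.one_le_rpow (x := 2) (by norm_num) hs0.le]
    set k := ⌊θ * n * Real.log n⌋₊
    have hk : (k : ℝ) ≤ τ * n * Real.log n := by
      refine (Nat.cast_le.2 (Nat.floor_mono ?_)).trans
        (Nat.floor_le (a := τ * n * Real.log n) (by positivity))
      gcongr
      exact le_max_left _ _
    have h1 := transition_iterate_le hn (S := Set.univ) (fun _ _ _ _ _ => Set.mem_univ _)
      (f := powerSum (1 - s)) (ρ := 1 + 2 * (2 ^ s - 1) / n) (b := 0) (by positivity)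
      (fun x _ => by simpa using transition_powerSum_one_sub_le hn hs0.le hs1.le x) k
      (unitMass n) (Set.mem_univ _)
    rw [powerSum_unitMass hn (by linarith), mul_one, zero_mul, add_zero] at h1
    have h2 : (1 + 2 * (2 ^ s - 1) / (n : ℝ)) ^ k ≤ (n : ℝ) ^ (2 * τ * (2 ^ s - 1)) := by
      calc (1 + 2 * (2 ^ s - 1) / (n : ℝ)) ^ k ≤ Real.exp (2 * (2 ^ s - 1) / n) ^ k := by
            gcongr
            linarith [Real.add_one_le_exp (2 * (2 ^ s - 1) / (n : ℝ))]
        _ = Real.exp (2 * (2 ^ s - 1) / n * k) := by rw [← Real.exp_nat_mul]; ring_nf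
        _ ≤ Real.exp (2 * (2 ^ s - 1) / n * (τ * n * Real.log n)) := by gcongr
        _ = _ := by
            rw [Real.rpow_def_of_pos hn0]
            congr 1
            field_simp
    calc _ ≤ 2 * (n : ℝ) ^ (-s) * (n : ℝ) ^ (2 * τ * (2 ^ s - 1)) := by
          gcongr
          exact h1.trans h2
      _ = _ := by
          rw [mul_assoc, ← Real.rpow_add hn0]
          congr 2
          ring

/-- After the critical time, the mean `L¹` deviation tends to zero. -/
lemma tendsto_transition_deviation {θ : ℝ} (hθ : 1 / (2 * Real.log 2) < θ) :
    Tendsto (fun n : ℕ => transition^[⌊θ * n * Real.log n⌋₊] deviation (unitMass n))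
      atTop (𝓝 0) := by
  obtain ⟨θ', hθ', hlt⟩ := exists_between hθ
  obtain ⟨s, hs0, hs1, hs⟩ := exists_exponent_of_supercritical hθ'
  have hθ'0 : 0 < θ' := lt_trans (by have := Real.log_pos (x := 2) (by norm_num); positivity) hθ'
  -- Truncation height `n ^ (η - 1)` and weight `n ^ η`, with `η` small against `θ - θ'`.
  set η := (θ - θ') / 4 with hη
  have hη0 : 0 < η := by linarith
  have hpow : (2 : ℝ) ^ (-s) < 1 := Real.rpow_lt_one_of_one_lt_of_neg (by norm_num) (by linarith)
  have hpow0 : (0 : ℝ) < 2 ^ (-s) := by positivity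
  set γ : ℝ := 2 * (1 - 2 ^ (-s)) with hγ
  set C : ℝ := 4 / (1 - 2 ^ (-s)) with hC
  have hlim : Tendsto (fun n : ℕ => 2 * (Real.exp γ + C) * (n : ℝ) ^ (-(η * s)) +
      (Real.exp 1 * (n : ℝ) ^ (-(2 * η)) + (n : ℝ) ^ (-η))) atTop (𝓝 0) := by
    have h1 := (tendsto_natCast_rpow_neg (mul_pos hη0 hs0)).const_mul (2 * (Real.exp γ + C))
    have h2 := (tendsto_natCast_rpow_neg (mul_pos two_pos hη0)).const_mul (Real.exp 1)
    simpa using h1.add (h2.add (tendsto_natCast_rpow_neg hη0))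
  refine tendsto_of_tendsto_of_tendsto_of_le_of_le' tendsto_const_nhds hlim ?_ ?_
  · filter_upwards [eventually_ge_atTop 2] with n hn
    exact transition_iterate_nonneg hn deviation_nonneg _ _
  · filter_upwards [eventually_ge_atTop 2] with n hn
    have hn2 : (2 : ℝ) ≤ n := by exact_mod_cast hn
    have hn0 : (0 : ℝ) < n := by positivity
    have hL : 0 ≤ Real.log n := Real.log_nonneg (by linarith)
    set k := ⌊θ * n * Real.log n⌋₊
    set k₁ := ⌊θ' * n * Real.log n⌋₊
    have hk₁k : k₁ ≤ k := Nat.floor_mono (by gcongr)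
    obtain ⟨k₂, hk₂⟩ := Nat.exists_eq_add_of_le hk₁k
    have hk₁ub : (k₁ : ℝ) ≤ θ' * n * Real.log n := Nat.floor_le (by positivity)
    have hk₁lb : θ' * n * Real.log n - 1 ≤ k₁ := (Nat.sub_one_lt_floor _).le
    have hklb : θ * n * Real.log n - 1 ≤ k := (Nat.sub_one_lt_floor _).le
    have hk₂lb : 4 * η * n * Real.log n - 1 ≤ k₂ := by
      have : (k : ℝ) = k₁ + k₂ := by rw [hk₂]; push_cast; rfl
      rw [hη]
      linarith
    have hmain := transition_iterate_add_deviation_le hn hs0 hs1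
      (a := (n : ℝ) ^ (η - 1)) (t := (n : ℝ) ^ η) (by positivity) (by positivity) k₁ k₂
      (sum_abs_unitMass hn).le
    rw [← hk₂, powerSum_unitMass hn (by linarith), mul_one, ← hγ, ← hC] at hmain
    refine hmain.trans (add_le_add ?_ (add_le_add ?_ ?_))
    · have h1 : (1 - γ / n) ^ k₁ ≤ Real.exp γ * (n : ℝ) ^ (-s) := by
        refine (one_sub_div_pow_le hn (by linarith) (by linarith) hk₁lb).trans ?_
        gcongr
        linarith
      calc _ ≤ 2 * ((n : ℝ) ^ (η - 1)) ^ (-s) *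
            (Real.exp γ * (n : ℝ) ^ (-s) + C * (n : ℝ) ^ (-s)) := by gcongr
        _ = 2 * (Real.exp γ + C) * ((n : ℝ) ^ ((η - 1) * -s) * (n : ℝ) ^ (-s)) := by
            rw [← Real.rpow_mul hn0.le]; ring
        _ = _ := by
            rw [← Real.rpow_add hn0]
            congr 2
            ring
    · have h1 := one_sub_div_pow_le hn zero_le_one one_le_two hk₂lb
      calc _ ≤ n * (n : ℝ) ^ η * (Real.exp 1 * (n : ℝ) ^ (-(1 * (4 * η))) *
            (n : ℝ) ^ (η - 1)) := by gcongr
        _ = Real.exp 1 * ((n : ℝ) ^ (1 : ℝ) * (n : ℝ) ^ η * (n : ℝ) ^ (-(1 * (4 * η))) *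
            (n : ℝ) ^ (η - 1)) := by rw [Real.rpow_one]; ring
        _ = _ := by
            rw [← Real.rpow_add hn0, ← Real.rpow_add hn0, ← Real.rpow_add hn0]
            congr 2
            ring
    · rw [Real.rpow_neg hn0.le, one_div]

lemma tendsto_measure_zero_of_le {u : ℕ → ENNReal} {b : ℕ → ℝ} {ε : ℝ}
    (hb : Tendsto b atTop (𝓝 0)) (h : ∀ n, 2 ≤ n → u n ≤ ENNReal.ofReal (b n / ε)) :
    Tendsto u atTop (𝓝 0) := by
  have hlim : Tendsto (fun n => ENNReal.ofReal (b n / ε)) atTop (𝓝 0) := by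
    simpa using ENNReal.tendsto_ofReal (hb.div_const ε)
  refine tendsto_of_tendsto_of_tendsto_of_le_of_le' tendsto_const_nhds hlim
    (Eventually.of_forall fun _ => zero_le) ?_
  filter_upwards [eventually_ge_atTop 2] with n hn using h n hn

end RepeatedAverages

theorem theorem1 {Ω : ℕ → Type*} [∀ n, MeasurableSpace (Ω n)] (μ : ∀ n, Measure (Ω n))
    (p : ∀ n, ℕ → Ω n → Fin n × Fin n)
    (hp : ∀ n, 2 ≤ n → RepeatedAverages.IsUniformPairs (μ n) (p n)) :
    (∀ θ : ℝ, θ < 1 / (2 * Real.log 2) →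
      RepeatedAverages.ConvergesInProbability μ
        (fun n ω => RepeatedAverages.T (RepeatedAverages.unitMass n) (fun k => p n k ω)
          ⌊θ * n * Real.log n⌋₊) 2) ∧
    (∀ θ : ℝ, 1 / (2 * Real.log 2) < θ →
      RepeatedAverages.ConvergesInProbability μ
        (fun n ω => RepeatedAverages.T (RepeatedAverages.unitMass n) (fun k => p n k ω)
          ⌊θ * n * Real.log n⌋₊) 0) := by
  refine ⟨fun θ hθ ε hε => ?_, fun θ hθ ε hε => ?_⟩
  · have hlog : 0 < Real.log 2 := Real.log_pos (by norm_num)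
    obtain ⟨s, hs0, hs1, hs⟩ := RepeatedAverages.exists_exponent_of_subcritical
      (le_max_right θ 0) (max_lt hθ (by positivity))
    refine RepeatedAverages.tendsto_measure_zero_of_le (ε := ε)
      (RepeatedAverages.tendsto_transition_powerSum hs0 hs1 hs) fun n hn => ?_
    have hn0 : (0 : ℝ) < n := by positivity
    have hc : 0 < 2 * (n : ℝ) ^ (-s) := by positivity
    have h := (hp n hn).measure_le hn (RepeatedAverages.unitMass n) ⌊θ * n * Real.log n⌋₊
      (RepeatedAverages.powerSum_nonneg (1 - s)) (div_pos hε hc)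
    rw [div_div_eq_mul_div, mul_comm _ (2 * (n : ℝ) ^ (-s))] at h
    refine (measure_mono fun ω hω => ?_).trans h
    exact (div_le_iff₀' hc).2
      (le_trans hω (RepeatedAverages.abs_T_sub_two_le hn hs0.le hs1.le _ _))
  · refine RepeatedAverages.tendsto_measure_zero_of_le (ε := ε)
      (RepeatedAverages.tendsto_transition_deviation hθ) fun n hn => ?_
    refine (measure_mono fun ω hω => ?_).trans ((hp n hn).measure_le hn
      (RepeatedAverages.unitMass n) ⌊θ * n * Real.log n⌋₊
      RepeatedAverages.deviation_nonneg hε)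
    have h : ε ≤ |RepeatedAverages.T (RepeatedAverages.unitMass n) (fun k => p n k ω)
      ⌊θ * n * Real.log n⌋₊ - 0| := hω
    rwa [sub_zero, RepeatedAverages.T_eq_deviation,
      abs_of_nonneg (RepeatedAverages.deviation_nonneg _)] at h
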